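/- A rank-1 $\mathbb F_2$-Grassmannian complex $X$ in $\mathbb F_2^k$ is a nonempty family of linear subspaces of $\mathbb F_2^k$ that is closed under taking subspaces and in which every member is contained in a 2-dimensional member, all members having dimension at most 2, together with a standard weight function $m_X\ge 0$: for each $d\in\{0,1,2\}$, $m_X$ is a probability distribution on the $d$-dimensional members, and for $d\le 1$ a random $d$-dimensional member is obtained by sampling a $(d+1)$-dimensional member $y$ from $m_X$ and then a uniformly random $d$-dimensional subspace of $y$. Write $X(0)\subseteq\mathbb F_2^k\setminus\{0\}$ for the set of vertices, i.e. of the nonzero vectors $v$ with $\{0,v\}\in X$, and put $m_X(v)=m_X(\{0,v\})$. The 1-skeleton graph has vertex set $X(0)$, and distinct $v,v'$ are joined with weight $m(v,v')=\sum m_X(x_1)$, the sum being over the 2-dimensional $x_1\in X$ that contain $v$ and $v'$. The expansion $\lambda$ of $X$ is $\max\{|\lambda_2|,|\lambda_n|\}$, where $1=\lambda_1\ge\lambda_2\ge\dots\ge\lambda_n$ are the eigenvalues of the random walk matrix $W_{v,v'}=m(v,v')/\sum_w m(v,w)$ of this graph. $X$ is regular if all its vertices have the same weight. **Proposition.** Let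 $X$ be a rank-1 $\mathbb F_2$-Grassmannian complex in $\mathbb F_2^k$ in which every vertex has positive weight, with $\operatorname{span}X(0)=\mathbb F_2^k$ and expansion $\lambda<1$. Put $\varepsilon=\lambda/(1-\lambda)$. Then $X(0)$, with its vertex distribution $m_X$, is $\varepsilon$-biased: for every nonzero $u\in\mathbb F_2^k$, $$\Pr_{s\sim m_X|_{X(0)}}[s\cdot u=1]\in\left[\tfrac{1-\varepsilon}2,\tfrac{1+\varepsilon}2\right].$$ If moreover $X$ is regular, then: 1. $X(0)$ is an $\varepsilon$-biased set, i.e. the same bound holds for $s$ uniform in $X(0)$. 2. Let $G_X\in\mathbb F_2^{X(0)\times k}$ be the matrix whose rows are the elements of $X(0)$, and let $n=|X(0)|$. The code $\operatorname{im}G_X\subseteq\mathbb F_2^{n}$ is $\varepsilon$-balanced: every nonzero codeword $c$ has Hamming weight $|c|\in[(1-\varepsilon)n/2,(1+\varepsilon)n/2]$. 3. The code $\operatorname{im}G_X$ is nonzero, and its relative distance lies in $\left[\tfrac{1-\varepsilon}2,\tfrac{1+\varepsilon}2\right]$. -/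

import Mathlib

open Finset

noncomputable section

namespace GrassmannianCode

/-! ### Spectral expansion of weighted graphs -/

/-- The random walk matrix `W v v' = m v v' / deg v`, `deg v = ∑ w, m v w`, of the finite weighted
graph on `V` with (symmetric) edge weights `m`; a non-edge has weight `0`. -/
def randomWalkMatrix {V : Type*} [Fintype V] (m : V → V → ℝ) : Matrix V V ℝ :=
  Matrix.of fun v v' => m v v' / ∑ w, m v w

open Classical in
/-- The real eigenvalues `λ₁ ≥ λ₂ ≥ ⋯` of the random walk matrix, listed in decreasing order with
algebraic multiplicity. (For symmetric nonnegative weights and positive degrees the random walk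
matrix is similar to a symmetric matrix, so that all its `|V|` eigenvalues are real.) -/
def walkEigenvalues {V : Type*} [Fintype V] (m : V → V → ℝ) : List ℝ :=
  (randomWalkMatrix m).charpoly.roots.sort (· ≥ ·)

/-- The spectral expansion `max (|λ₂|, |λ_{|V|}|)` of a weighted graph (on at least two vertices). -/
def spectralExpansion {V : Type*} [Fintype V] (m : V → V → ℝ) : ℝ :=
  max |(walkEigenvalues m).getD 1 0| |(walkEigenvalues m).getLastD 0|

/-! ### Grassmannian complexes over `𝔽₂` -/

/-- The dimension of a linear subspace of `𝔽₂ᵏ`. -/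
abbrev dim {k : ℕ} (x : Submodule (ZMod 2) (Fin k → ZMod 2)) : ℕ :=
  Module.finrank (ZMod 2) x

open Classical in
/-- A rank-`r` `𝔽₂`-Grassmannian complex in the ambient space `𝔽₂ᵏ`: a nonempty, downward closed
family of linear subspaces, pure of rank `r`, with a standard weight function. The rank of a
subspace is its dimension minus one, so the faces of rank `i` are those of dimension `i + 1`. -/
structure GrassmannianComplex (k r : ℕ) where
  /-- the faces of the complex -/
  faces : Finset (Submodule (ZMod 2) (Fin k → ZMod 2))
  nonempty : faces.Nonempty
  down_closed : ∀ x ∈ faces, ∀ y : Submodule (ZMod 2) (Fin k → ZMod 2), y ≤ x → y ∈ faces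
  dim_le : ∀ x ∈ faces, dim x ≤ r + 1
  pure : ∀ x ∈ faces, ∃ y ∈ faces, x ≤ y ∧ dim y = r + 1
  /-- the weight function; only its values on faces matter -/
  weight : Submodule (ZMod 2) (Fin k → ZMod 2) → ℝ
  weight_nonneg : ∀ x ∈ faces, 0 ≤ weight x
  /-- on the faces of each dimension the weights form a probability distribution -/
  weight_sum : ∀ d ≤ r + 1, ∑ x ∈ faces with dim x = d, weight x = 1
  /-- the weight function is standard: a random `d`-dimensional face is obtained by sampling a
  `(d + 1)`-dimensional face `y` and then a uniform `d`-dimensional face contained in `y` -/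
  weight_standard : ∀ d ≤ r, ∀ x ∈ faces, dim x = d →
    weight x = ∑ y ∈ faces with dim y = d + 1 ∧ x < y,
      weight y / (#{x' ∈ faces | dim x' = d ∧ x' < y} : ℝ)

namespace GrassmannianComplex

variable {k r : ℕ} (X : GrassmannianComplex k r)

open Classical in
/-- The vertex set `X(0)`. A rank-`0` face is a line `{0, v}` over `𝔽₂`; it is identified with its
nonzero vector `v`. -/
def vertices : Finset (Fin k → ZMod 2) :=
  {v | v ≠ 0 ∧ Submodule.span (ZMod 2) {v} ∈ X.faces}

/-- The weight of a vertex, that is, of the line it spans. -/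
def vertexWeight (v : Fin k → ZMod 2) : ℝ :=
  X.weight (Submodule.span (ZMod 2) {v})

open Classical in
/-- The edge weights of the `1`-skeleton graph: two distinct vertices are joined with the total
weight of the rank-`1` faces (the planes of the complex) containing both. -/
def skeletonWeight (v v' : X.vertices) : ℝ :=
  if v = v' then 0
  else ∑ x ∈ X.faces with dim x = 2 ∧ v.1 ∈ x ∧ v'.1 ∈ x, X.weight x

/-- The expansion of `X`: the spectral expansion of its `1`-skeleton graph. -/
def expansion : ℝ :=
  spectralExpansion X.skeletonWeight

/-- `X` is regular if all vertices have the same weight. -/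
def IsRegular : Prop :=
  ∀ v ∈ X.vertices, ∀ w ∈ X.vertices, X.vertexWeight v = X.vertexWeight w

/-- The generating matrix `G_X`, whose rows are the elements of `X(0)`. -/
def generatorMatrix : Matrix X.vertices (Fin k) (ZMod 2) :=
  Matrix.of fun v j => v.1 j

/-- The code `im G_X = {G_X u : u ∈ 𝔽₂ᵏ}`. -/
def code : Submodule (ZMod 2) (X.vertices → ZMod 2) :=
  LinearMap.range X.generatorMatrix.mulVecLin

end GrassmannianComplex

/-! ### Biased sets and balanced codes -/

/-- The finite set `S ⊆ 𝔽₂ᵏ` is `ε`-biased with respect to the probability distribution `p` on `S`: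
for every `u ≠ 0`, the probability over `s ∼ p` that `s · u = 1` lies in
`[(1 - ε) / 2, (1 + ε) / 2]`. -/
def IsBiasedWith {k : ℕ} (S : Finset (Fin k → ZMod 2)) (p : (Fin k → ZMod 2) → ℝ) (ε : ℝ) : Prop :=
  ∀ u : Fin k → ZMod 2, u ≠ 0 →
    ∑ s ∈ S with s ⬝ᵥ u = 1, p s ∈ Set.Icc ((1 - ε) / 2) ((1 + ε) / 2)

/-- The finite set `S ⊆ 𝔽₂ᵏ` is `ε`-biased: for every `u ≠ 0`, the probability over uniform `s ∈ S`
that `s · u = 1` lies in `[(1 - ε) / 2, (1 + ε) / 2]`. -/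
def IsBiased {k : ℕ} (S : Finset (Fin k → ZMod 2)) (ε : ℝ) : Prop :=
  ∀ u : Fin k → ZMod 2, u ≠ 0 →
    (#{s ∈ S | s ⬝ᵥ u = 1} : ℝ) / (#S : ℝ) ∈ Set.Icc ((1 - ε) / 2) ((1 + ε) / 2)

/-- A linear code of length `n = |ι|` is `ε`-balanced if every nonzero codeword has Hamming weight
in `[(1 - ε) n / 2, (1 + ε) n / 2]`. -/
def IsBalanced {ι : Type*} [Fintype ι] (C : Submodule (ZMod 2) (ι → ZMod 2)) (ε : ℝ) : Prop :=
  ∀ c ∈ C, c ≠ 0 → (hammingNorm c : ℝ) ∈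
    Set.Icc ((1 - ε) * (Fintype.card ι : ℝ) / 2) ((1 + ε) * (Fintype.card ι : ℝ) / 2)

/-- The relative distance of a code with at least two codewords: the least Hamming distance between
two distinct codewords, divided by the length. -/
def relativeDistance {ι : Type*} [Fintype ι] (C : Submodule (ZMod 2) (ι → ZMod 2)) : ℝ :=
  (sInf {d : ℕ | ∃ c ∈ C, ∃ c' ∈ C, c ≠ c' ∧ hammingDist c c' = d} : ℕ) / (Fintype.card ι : ℝ)

end GrassmannianCode

end

/-! Fix `u ≠ 0` and let `A` be the set of vertices with `s ⬝ᵥ u = 1`, of weight `a`. A linear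
functional takes the value `1` on `0` or `2` of the three vertices of a plane
(`card_filter_vertices_dotProduct`), so the edge weight inside `A` is determined by `a` alone: the
indicator of `A` has quadratic form `3 * a`. Vertex degrees are `6` times vertex weights, so
centring the indicator gives form `3 * a - 6 * a ^ 2` and squared norm `6 * (a - a ^ 2)`.

The spectral bound `abs_sum_le_spectralExpansion` then yields `|1 - 2 * a| ≤ 2 * λ * (1 - a)` after
division by `3 * a`, which is positive because the vertices span. Writing `2 * (1 - a) = 1 + (1 - 2
* a)` and solving for the bias gives `λ / (1 - λ)`. For regular complexes, codeword weights count
the sets `A`, and linearity turns distances into weights. -/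

namespace GrassmannianCode

/-! ### Spectral bound for quadratic forms of weighted graphs -/

section Spectral

open Matrix

/-- Bound on the quadratic form of a real symmetric matrix on the orthogonal complement of an
eigenvector `h` of eigenvalue `1`, in terms of the eigenvalues other than the largest one. -/
lemma abs_dotProduct_mulVec_le {V : Type*} [Fintype V] [DecidableEq V] {S : Matrix V V ℝ}
    (hS : S.IsHermitian) {l : ℝ} (hl : l < 1)
    (hev : ∀ i, 0 < i.val → |hS.eigenvalues₀ i| ≤ l) {h g : V → ℝ} (hh : h ≠ 0)
    (hSh : S *ᵥ h = h) (hg : h ⬝ᵥ g = 0) : |g ⬝ᵥ (S *ᵥ g)| ≤ l * (g ⬝ᵥ g) := by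
  set b : V → V → ℝ := fun i => (hS.eigenvectorBasis i).ofLp
  have expand (x y : V → ℝ) : ∑ i, (x ⬝ᵥ b i) * (b i ⬝ᵥ y) = x ⬝ᵥ y := by
    have := hS.eigenvectorBasis.sum_inner_mul_inner (WithLp.toLp 2 x) (WithLp.toLp 2 y)
    simp only [EuclideanSpace.inner_eq_star_dotProduct, star_trivial] at this
    rw [dotProduct_comm x y, ← this]
    exact Finset.sum_congr rfl fun i _ => by
      rw [dotProduct_comm x, dotProduct_comm (b i) y]
  have eig (i : V) (x : V → ℝ) : b i ⬝ᵥ (S *ᵥ x) = hS.eigenvalues i * (b i ⬝ᵥ x) := by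
    have hT : Sᵀ = S := by simpa using hS.eq
    rw [dotProduct_mulVec, ← mulVec_transpose, hT, hS.mulVec_eigenvectorBasis, smul_dotProduct,
      smul_eq_mul]
  -- Only the index sorted first can violate the bound, so there is at most one exception.
  have large (i : V) (hi : ¬ |hS.eigenvalues i| ≤ l) (j : V) (hj : j ≠ i) :
      |hS.eigenvalues j| ≤ l := by
    simp only [IsHermitian.eigenvalues] at hi ⊢
    refine hev _ (Nat.pos_of_ne_zero fun h0 => hj ?_)
    have hi0 : _ = 0 := not_not.mp fun h1 => hi (hev _ (Nat.pos_of_ne_zero h1))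
    exact (Equiv.injective _ (Fin.ext (h0.trans hi0.symm)))
  have zero (i : V) (hi : |hS.eigenvalues i| ≤ l) : h ⬝ᵥ b i = 0 := by
    have h1 := eig i h
    rw [hSh] at h1
    have h2 : hS.eigenvalues i < 1 := (le_abs_self _).trans_lt (hi.trans_lt hl)
    rw [dotProduct_comm]
    nlinarith [mul_eq_zero.mp (show (1 - hS.eigenvalues i) * (b i ⬝ᵥ h) = 0 by linarith)
      |>.resolve_left (by linarith)]
  -- If `b i` is exceptional, `h` is orthogonal to every other basis vector, hence a nonzero
  -- multiple of `b i`, and `g` is orthogonal to it. That `1` is the top eigenvalue need not be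
  -- proved separately.
  have small (i : V) : |hS.eigenvalues i| ≤ l ∨ b i ⬝ᵥ g = 0 := by
    by_contra! hc
    have hi := large i (not_le.mpr hc.1)
    have hsum (y : V → ℝ) : (h ⬝ᵥ b i) * (b i ⬝ᵥ y) = h ⬝ᵥ y := by
      rw [← expand h y, Finset.sum_eq_single i
        (fun j _ hj => by rw [zero j (hi j hj), zero_mul]) fun hi => absurd (Finset.mem_univ i) hi]
    have hbi : h ⬝ᵥ b i = 0 :=
      (mul_eq_zero.mp ((hsum g).trans hg)).resolve_right hc.2
    refine hh (dotProduct_self_eq_zero.mp ?_)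
    rw [← hsum h, hbi, zero_mul]
  rw [← expand g (S *ᵥ g), ← expand g g, Finset.mul_sum]
  refine (Finset.abs_sum_le_sum_abs _ _).trans (Finset.sum_le_sum fun i _ => ?_)
  rw [eig, dotProduct_comm g]
  rcases small i with hi | hi
  · calc |b i ⬝ᵥ g * (hS.eigenvalues i * b i ⬝ᵥ g)|
        = |hS.eigenvalues i| * (b i ⬝ᵥ g * b i ⬝ᵥ g) := by
          rw [mul_left_comm, abs_mul, abs_mul_self]
      _ ≤ _ := mul_le_mul_of_nonneg_right hi (mul_self_nonneg _)
  · simp [hi]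

variable {V : Type*} [Fintype V] (m : V → V → ℝ)

/-- The symmetric matrix `D^{-1/2} M D^{-1/2}` similar to the random walk matrix `D⁻¹ M`. -/
noncomputable def normalizedAdjMatrix : Matrix V V ℝ :=
  Matrix.of fun v w => m v w / (√(∑ x, m v x) * √(∑ x, m w x))

variable {m}

lemma normalizedAdjMatrix_isHermitian (hm : ∀ v w, m v w = m w v) :
    (normalizedAdjMatrix m).IsHermitian := by
  ext v w
  simp [normalizedAdjMatrix, hm w v, mul_comm]

/-- The two matrices are conjugate by the diagonal matrix of square roots of degrees. -/
lemma charpoly_randomWalkMatrix [DecidableEq V] (hd : ∀ v, 0 < ∑ w, m v w) :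
    (randomWalkMatrix m).charpoly = (normalizedAdjMatrix m).charpoly := by
  have hs (v : V) : √(∑ x, m v x) ≠ 0 := (Real.sqrt_pos.mpr (hd v)).ne'
  have h1 : randomWalkMatrix m = diagonal (fun v => (√(∑ x, m v x))⁻¹) *
      (normalizedAdjMatrix m * diagonal fun v => √(∑ x, m v x)) := by
    ext v w
    rw [diagonal_mul, mul_diagonal]
    simp only [randomWalkMatrix, normalizedAdjMatrix, of_apply]
    have h2 := Real.mul_self_sqrt (hd v).le
    have := hs v
    have := hs w
    nth_rewrite 1 [← h2]
    field_simp
  rw [h1, charpoly_mul_comm, mul_assoc, diagonal_mul_diagonal]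
  simp [hs]

lemma walkEigenvalues_eq_ofFn [DecidableEq V] (hm : ∀ v w, m v w = m w v)
    (hd : ∀ v, 0 < ∑ w, m v w) :
    walkEigenvalues m = List.ofFn (normalizedAdjMatrix_isHermitian hm).eigenvalues₀ := by
  rw [← IsHermitian.sort_roots_charpoly_eq_eigenvalues₀, ← charpoly_randomWalkMatrix hd]
  simp only [RCLike.re_to_real, Multiset.map_id', walkEigenvalues]
  congr!

lemma spectralExpansion_nonneg : 0 ≤ spectralExpansion m :=
  (abs_nonneg _).trans (le_max_left _ _)

lemma abs_le_max_of_antitone {n : ℕ} {a : Fin n → ℝ} (ha : Antitone a) (i : Fin n)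
    (hi : 0 < i.val) :
    |a i| ≤ max |(List.ofFn a).getD 1 0| |(List.ofFn a).getLastD 0| := by
  -- A positive index forces length at least two, so neither list default is ever used.
  obtain ⟨n, rfl⟩ : ∃ p, n = p + 2 := ⟨n - 2, by omega⟩
  have h1 : (List.ofFn a).getD 1 0 = a 1 := by simp [List.getD]
  have h2 : (List.ofFn a).getLastD 0 = a (Fin.last _) := by
    rw [List.getLastD_eq_getLast?, List.getLast?_eq_getElem?]
    rw [List.length_ofFn, List.getElem?_ofFn]
    simp [Fin.last]
  rw [h1, h2, max_comm]
  have h3 : a i ≤ a 1 := ha (Fin.one_le_of_ne_zero (Fin.pos_iff_ne_zero.mp hi))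
  have h4 : a (Fin.last _) ≤ a i := ha (Fin.le_last i)
  exact abs_le_max_abs_abs h4 h3

/-- On functions of mean zero for the stationary distribution, the quadratic form of a connected
weighted graph is controlled by its spectral expansion. -/
theorem abs_sum_le_spectralExpansion [Nonempty V] (hm : ∀ v w, m v w = m w v)
    (hd : ∀ v, 0 < ∑ w, m v w) (hl : spectralExpansion m < 1) {f : V → ℝ}
    (hf : ∑ v, (∑ w, m v w) * f v = 0) :
    |∑ v, ∑ w, m v w * (f v * f w)| ≤ spectralExpansion m * ∑ v, (∑ w, m v w) * f v ^ 2 := by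
  classical
  set h : V → ℝ := fun v => √(∑ x, m v x)
  have hs (v : V) : h v ≠ 0 := (Real.sqrt_pos.mpr (hd v)).ne'
  have hsq (v : V) : h v * h v = ∑ x, m v x := Real.mul_self_sqrt (hd v).le
  have hS := normalizedAdjMatrix_isHermitian hm
  have happ (v w : V) : normalizedAdjMatrix m v w = m v w / (h v * h w) := rfl
  -- Scaling by the square roots of degrees turns the constant function into the eigenvector `h` and
  -- `f` into a vector orthogonal to it.
  have key := abs_dotProduct_mulVec_le hS hl (h := h) (g := fun v => h v * f v) ?_ ?_ ?_ ?_
  · convert key using 2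
    · refine Finset.sum_congr rfl fun v _ => ?_
      rw [mulVec, dotProduct, Finset.mul_sum]
      refine Finset.sum_congr rfl fun w _ => ?_
      rw [happ]
      have := hs v
      have := hs w
      field_simp
    · refine Finset.sum_congr rfl fun v _ => ?_
      rw [← hsq]
      ring
  · intro i hi
    rw [spectralExpansion, walkEigenvalues_eq_ofFn hm hd]
    exact abs_le_max_of_antitone hS.eigenvalues₀_antitone i hi
  · exact fun h0 => hs (Classical.arbitrary V) (congrFun h0 _)
  · ext v
    have h1 (w : V) : normalizedAdjMatrix m v w * h w = m v w / h v := by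
      rw [happ]
      have := hs v
      have := hs w
      field_simp
    simp only [mulVec, dotProduct, h1]
    rw [← Finset.sum_div, ← hsq, mul_div_assoc, div_self (hs v), mul_one]
  · rw [← hf]
    refine Finset.sum_congr rfl fun v _ => ?_
    rw [← hsq]
    ring

end Spectral

end GrassmannianCode

namespace GrassmannianCode

/-! ### Linear functionals on subspaces over `𝔽₂` -/

section Combinatorics

variable {k : ℕ}

lemma mem_span_singleton_zmod_two {v w : Fin k → ZMod 2} :
    w ∈ Submodule.span (ZMod 2) {v} ↔ w = 0 ∨ w = v := by
  rw [Submodule.mem_span_singleton]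
  constructor
  · rintro ⟨a, rfl⟩
    fin_cases a
    · exact Or.inl (zero_smul _ v)
    · exact Or.inr (one_smul _ v)
  · rintro (rfl | rfl)
    · exact ⟨0, zero_smul _ v⟩
    · exact ⟨1, one_smul _ _⟩

open Classical in
lemma card_filter_mem_submodule (x : Submodule (ZMod 2) (Fin k → ZMod 2)) :
    #{v : Fin k → ZMod 2 | v ∈ x} = 2 ^ dim x := by
  have h := Module.natCard_eq_pow_finrank (K := ZMod 2) (V := x)
  rw [Nat.card_zmod] at h
  rw [← h, Nat.card_eq_fintype_card, Fintype.card_subtype]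

open Classical in
/-- A linear functional that is nonzero on a subspace over `𝔽₂` takes the value `1` on half of it. -/
lemma two_mul_card_filter_dotProduct_eq_one {x : Submodule (ZMod 2) (Fin k → ZMod 2)}
    {u v₀ : Fin k → ZMod 2} (hv₀ : v₀ ∈ x) (h1 : v₀ ⬝ᵥ u = 1) :
    2 * #{v | v ∈ x ∧ v ⬝ᵥ u = 1} = 2 ^ dim x := by
  have hself : v₀ + v₀ = 0 := funext fun i => CharTwo.add_self_eq_zero (v₀ i)
  have hzo : ∀ a : ZMod 2, a = 0 ∨ a = 1 := by decide
  have hone : (1 : ZMod 2) + 1 = 0 := rfl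
  have hsplit := Finset.card_filter_add_card_filter_not (s := {v | v ∈ x})
    (fun v : Fin k → ZMod 2 => v ⬝ᵥ u = 1)
  rw [card_filter_mem_submodule, Finset.filter_filter, Finset.filter_filter] at hsplit
  -- Translation by `v₀` swaps the two fibres of the functional.
  have hcard : #{v | v ∈ x ∧ v ⬝ᵥ u = 1} = #{v | v ∈ x ∧ ¬ v ⬝ᵥ u = 1} := by
    refine Finset.card_nbij' (· + v₀) (· + v₀) ?_ ?_ ?_ ?_
    · intro v hv
      simp only [coe_filter, mem_univ, true_and, Set.mem_ofPred_eq] at hv ⊢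
      refine ⟨x.add_mem hv.1 hv₀, ?_⟩
      rw [add_dotProduct, hv.2, h1, hone]
      exact zero_ne_one
    · intro v hv
      simp only [coe_filter, mem_univ, true_and, Set.mem_ofPred_eq] at hv ⊢
      refine ⟨x.add_mem hv.1 hv₀, ?_⟩
      rw [add_dotProduct, h1, (hzo _).resolve_right hv.2, zero_add]
    · intro v _
      simp [add_assoc, hself]
    · intro v _
      simp [add_assoc, hself]
  omega

end Combinatorics

/-! ### Incidences of vertices and planes -/

namespace GrassmannianComplex

variable {k : ℕ}

lemma ne_zero_of_mem_vertices {r : ℕ} {X : GrassmannianComplex k r} {v : Fin k → ZMod 2}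
    (hv : v ∈ X.vertices) : v ≠ 0 := by
  classical
  exact (Finset.mem_filter.mp hv).2.1

lemma mem_vertices_of_mem_face {r : ℕ} {X : GrassmannianComplex k r}
    {x : Submodule (ZMod 2) (Fin k → ZMod 2)} (hx : x ∈ X.faces) {v : Fin k → ZMod 2} (hv : v ∈ x)
    (h0 : v ≠ 0) : v ∈ X.vertices := by
  classical
  refine Finset.mem_filter.mpr ⟨mem_univ _, h0, X.down_closed x hx _ ?_⟩
  simpa using hv

open Classical in
/-- The lines of the complex are the spans of its vertices. -/
lemma sum_lines_eq_sum_vertices {r : ℕ} (X : GrassmannianComplex k r)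
    (F : Submodule (ZMod 2) (Fin k → ZMod 2) → ℝ) :
    ∑ x ∈ X.faces with dim x = 1, F x = ∑ v ∈ X.vertices, F (Submodule.span (ZMod 2) {v}) := by
  symm
  refine Finset.sum_bij (fun v _ => Submodule.span (ZMod 2) {v}) ?_ ?_ ?_ fun _ _ => rfl
  · intro v hv
    exact Finset.mem_filter.mpr
      ⟨(Finset.mem_filter.mp hv).2.2, finrank_span_singleton (ne_zero_of_mem_vertices hv)⟩
  · intro v hv w _ hvw
    have h : v ∈ Submodule.span (ZMod 2) {w} := hvw ▸ Submodule.mem_span_singleton_self v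
    exact (mem_span_singleton_zmod_two.mp h).resolve_left (ne_zero_of_mem_vertices hv)
  · intro x hx
    obtain ⟨hxf, hx1⟩ := Finset.mem_filter.mp hx
    obtain ⟨⟨v, hv⟩, hv0, hsp⟩ := finrank_eq_one_iff'.mp hx1
    have hv0' : v ≠ 0 := fun h => hv0 (Subtype.ext h)
    refine ⟨v, mem_vertices_of_mem_face hxf hv hv0', le_antisymm (by simpa using hv) ?_⟩
    intro w hw
    obtain ⟨c, hc⟩ := hsp ⟨w, hw⟩
    exact Submodule.mem_span_singleton.mpr ⟨c, congrArg Subtype.val hc⟩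

/-- The vertex weights form a probability distribution. -/
lemma sum_vertexWeight {r : ℕ} (X : GrassmannianComplex k r) :
    ∑ v ∈ X.vertices, X.vertexWeight v = 1 := by
  classical
  rw [← X.weight_sum 1 (by omega), sum_lines_eq_sum_vertices]
  rfl

lemma vertices_nonempty {r : ℕ} (X : GrassmannianComplex k r) : X.vertices.Nonempty := by
  by_contra h
  have := X.sum_vertexWeight
  rw [Finset.not_nonempty_iff_eq_empty.mp h] at this
  simp at this

open Classical in
lemma card_filter_vertices_mem {r : ℕ} (X : GrassmannianComplex k r)
    {x : Submodule (ZMod 2) (Fin k → ZMod 2)} (hx : x ∈ X.faces) :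
    #{v ∈ X.vertices | v ∈ x} = 2 ^ dim x - 1 := by
  have h : ({v ∈ X.vertices | v ∈ x} : Finset _) = ({v | v ∈ x} : Finset _).erase 0 := by
    ext v
    simp only [mem_filter, mem_erase, mem_univ, true_and]
    exact ⟨fun h => ⟨ne_zero_of_mem_vertices h.1, h.2⟩,
      fun h => ⟨mem_vertices_of_mem_face hx h.2 h.1, h.2⟩⟩
  rw [h, Finset.card_erase_of_mem (by simp), card_filter_mem_submodule]

open Classical in
/-- A linear functional takes the value `1` on zero or two of the three vertices of a plane. -/
lemma card_filter_vertices_dotProduct {r : ℕ} (X : GrassmannianComplex k r)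
    {x : Submodule (ZMod 2) (Fin k → ZMod 2)} (hx : x ∈ X.faces) (h2 : dim x = 2)
    (u : Fin k → ZMod 2) :
    #{v ∈ X.vertices | v ∈ x ∧ v ⬝ᵥ u = 1} = 0 ∨ #{v ∈ X.vertices | v ∈ x ∧ v ⬝ᵥ u = 1} = 2 := by
  have h : ({v ∈ X.vertices | v ∈ x ∧ v ⬝ᵥ u = 1} : Finset _) =
      ({v | v ∈ x ∧ v ⬝ᵥ u = 1} : Finset _) := by
    ext v
    simp only [mem_filter, mem_univ, true_and, and_iff_right_iff_imp]
    rintro ⟨hv, h1⟩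
    refine mem_vertices_of_mem_face hx hv ?_
    rintro rfl
    simp at h1
  rw [h]
  rcases Finset.eq_empty_or_nonempty ({v | v ∈ x ∧ v ⬝ᵥ u = 1} : Finset _) with h0 | ⟨v, hv⟩
  · exact Or.inl (by rw [h0, card_empty])
  · simp only [mem_filter, mem_univ, true_and] at hv
    have := two_mul_card_filter_dotProduct_eq_one hv.1 hv.2
    rw [h2] at this
    omega

variable (X : GrassmannianComplex k 1)

open Classical in
/-- Every plane has three lines, so a vertex has a third of the weight of the planes through it. -/
lemma vertexWeight_eq {v : Fin k → ZMod 2} (hv : v ∈ X.vertices) :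
    X.vertexWeight v = (∑ x ∈ X.faces with dim x = 2, if v ∈ x then X.weight x else 0) / 3 := by
  have hv1 : dim (Submodule.span (ZMod 2) {v}) = 1 :=
    finrank_span_singleton (ne_zero_of_mem_vertices hv)
  have hlt {y : Submodule (ZMod 2) (Fin k → ZMod 2)} (hy : dim y = 2) {w : Fin k → ZMod 2}
      (hw : dim (Submodule.span (ZMod 2) {w}) = 1) : Submodule.span (ZMod 2) {w} < y ↔ w ∈ y := by
    constructor
    · exact fun h => h.le (Submodule.mem_span_singleton_self w)
    · refine fun h => lt_of_le_of_ne (by simpa using h) ?_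
      rintro rfl
      omega
  rw [vertexWeight, X.weight_standard 1 le_rfl _ (Finset.mem_filter.mp hv).2.2 hv1,
    ← Finset.sum_filter, Finset.filter_filter, Finset.sum_div]
  refine Finset.sum_congr (Finset.filter_congr fun y _ => ?_) fun y hy => ?_
  · exact and_congr_right fun h => hlt h hv1
  · obtain ⟨hyf, hy2, -⟩ := Finset.mem_filter.mp hy
    congr 1
    have h1 := X.sum_lines_eq_sum_vertices fun z => if z < y then 1 else 0
    rw [← Finset.sum_filter, Finset.filter_filter, ← Finset.sum_filter] at h1
    simp only [sum_const, nsmul_eq_mul, mul_one] at h1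
    rw [h1, Finset.filter_congr fun w hw =>
      hlt hy2 (finrank_span_singleton (ne_zero_of_mem_vertices hw)),
      X.card_filter_vertices_mem hyf, hy2]
    norm_num

open Classical in
/-- Averages over vertices are averages over planes. -/
lemma three_mul_sum_vertexWeight_mul (g : (Fin k → ZMod 2) → ℝ) :
    3 * ∑ v ∈ X.vertices, X.vertexWeight v * g v =
      ∑ x ∈ X.faces with dim x = 2, X.weight x * ∑ v ∈ X.vertices with v ∈ x, g v := by
  rw [Finset.mul_sum]
  simp_rw [Finset.mul_sum, Finset.sum_filter (fun v => v ∈ _)]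
  rw [Finset.sum_comm]
  refine Finset.sum_congr rfl fun v hv => ?_
  rw [vertexWeight_eq X hv, ← mul_assoc, mul_div_cancel₀ _ three_ne_zero, Finset.sum_mul]
  refine Finset.sum_congr rfl fun x _ => ?_
  rw [ite_mul, zero_mul]

lemma skeletonWeight_symm (v w : X.vertices) : X.skeletonWeight v w = X.skeletonWeight w v := by
  classical
  simp only [skeletonWeight, eq_comm (a := v), and_comm (a := v.1 ∈ _)]

open Classical in
lemma sum_skeletonWeight_mul (v : X.vertices) (g : (Fin k → ZMod 2) → ℝ) :
    ∑ w, X.skeletonWeight v w * g w = ∑ x ∈ X.faces with dim x = 2,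
      if v.1 ∈ x then X.weight x * (∑ w ∈ X.vertices with w ∈ x, g w - g v) else 0 := by
  -- The subtracted term removes the diagonal `w = v`, since the skeleton has no loops.
  have h (w : X.vertices) : X.skeletonWeight v w * g w = ∑ x ∈ X.faces with dim x = 2,
      if v.1 ∈ x then X.weight x *
        ((if w.1 ∈ x then g w else 0) - if w = v then g v else 0) else 0 := by
    unfold skeletonWeight
    by_cases hvw : v = w
    · subst hvw
      rw [if_pos rfl, zero_mul]
      refine (Finset.sum_eq_zero fun x _ => ?_).symm
      by_cases h1 : v.1 ∈ x <;> simp [h1]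
    · rw [if_neg hvw, ← Finset.filter_filter, Finset.sum_filter, Finset.sum_mul]
      refine Finset.sum_congr rfl fun x _ => ?_
      have : w ≠ v := fun h => hvw h.symm
      by_cases h1 : v.1 ∈ x <;> by_cases h2 : w.1 ∈ x <;> simp [h1, h2, this]
  rw [Finset.sum_congr rfl fun w _ => h w, Finset.sum_comm]
  refine Finset.sum_congr rfl fun x _ => ?_
  split_ifs
  · rw [← Finset.mul_sum, Finset.sum_sub_distrib, Finset.sum_filter,
      ← Finset.sum_coe_sort X.vertices]
    simp
  · simp

/-- Each plane through `v` contributes its two other vertices, and the planes through `v` have total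
weight `3 * X.vertexWeight v`. -/
lemma sum_skeletonWeight (v : X.vertices) :
    ∑ w, X.skeletonWeight v w = 6 * X.vertexWeight v := by
  classical
  have h := X.sum_skeletonWeight_mul v fun _ => 1
  simp only [mul_one] at h
  rw [h, vertexWeight_eq X v.2, show (6 : ℝ) = 2 * 3 by norm_num, mul_assoc,
    mul_div_cancel₀ _ three_ne_zero, Finset.mul_sum]
  refine Finset.sum_congr rfl fun x hx => ?_
  obtain ⟨hxf, hx2⟩ := Finset.mem_filter.mp hx
  have h3 := X.card_filter_vertices_mem hxf
  rw [hx2] at h3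
  split_ifs
  · rw [Finset.sum_const, h3]
    norm_num
    ring
  · simp

open Classical in
/-- The quadratic form of the `1`-skeleton as a sum over the planes of the complex. -/
lemma sum_sum_skeletonWeight_mul (g : (Fin k → ZMod 2) → ℝ) :
    ∑ v : X.vertices, ∑ w : X.vertices, X.skeletonWeight v w * (g v * g w) =
      ∑ x ∈ X.faces with dim x = 2, X.weight x *
        ((∑ v ∈ X.vertices with v ∈ x, g v) ^ 2 - ∑ v ∈ X.vertices with v ∈ x, g v ^ 2) := by
  have h (v : X.vertices) : ∑ w : X.vertices, X.skeletonWeight v w * (g v * g w) =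
      ∑ x ∈ X.faces with dim x = 2, if v.1 ∈ x then
        X.weight x * ((∑ w ∈ X.vertices with w ∈ x, g w) * g v - g v ^ 2) else 0 := by
    simp_rw [mul_left_comm _ (g v)]
    rw [← Finset.mul_sum, sum_skeletonWeight_mul, Finset.mul_sum]
    refine Finset.sum_congr rfl fun x _ => ?_
    split_ifs <;> ring
  rw [Finset.sum_congr rfl fun v _ => h v, Finset.sum_coe_sort X.vertices fun v =>
    ∑ x ∈ X.faces with dim x = 2, if v ∈ x then
        X.weight x * ((∑ w ∈ X.vertices with w ∈ x, g w) * g v - g v ^ 2) else 0,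
    Finset.sum_comm]
  refine Finset.sum_congr rfl fun x _ => ?_
  rw [← Finset.sum_filter, ← Finset.mul_sum, Finset.sum_sub_distrib, ← Finset.mul_sum, sq]

end GrassmannianComplex

end GrassmannianCode

namespace GrassmannianCode

/-! ### From expansion to bias -/

namespace GrassmannianComplex

variable {k : ℕ} (X : GrassmannianComplex k 1)

/-- The expander mixing estimate for the vertices off a hyperplane: a plane of the complex not
inside the hyperplane has exactly one edge among them. -/
lemma abs_bias_le (hpos : ∀ v ∈ X.vertices, 0 < X.vertexWeight v) (hlam : X.expansion < 1)
    {u : Fin k → ZMod 2} {a : ℝ} (ha : a = ∑ s ∈ X.vertices with s ⬝ᵥ u = 1, X.vertexWeight s) :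
    |3 * a - 6 * a ^ 2| ≤ X.expansion * (6 * (a - a ^ 2)) := by
  classical
  have : Nonempty X.vertices := X.vertices_nonempty.to_subtype
  set e : (Fin k → ZMod 2) → ℝ := fun v => if v ⬝ᵥ u = 1 then 1 else 0
  have he2 (v : Fin k → ZMod 2) : e v ^ 2 = e v := by simp only [e]; split_ifs <;> simp
  have hsum : ∑ v ∈ X.vertices, X.vertexWeight v * e v = a := by
    simp only [e, mul_ite, mul_one, mul_zero]
    rw [ha, Finset.sum_filter]
  have h1 := X.sum_vertexWeight
  have h3 := X.three_mul_sum_vertexWeight_mul e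
  have h4 := X.weight_sum 2 le_rfl
  have key := abs_sum_le_spectralExpansion X.skeletonWeight_symm
    (fun v => by rw [sum_skeletonWeight]; linarith [hpos v v.2]) hlam (f := fun v => e v - a) ?_
  · convert key using 2
    · rw [X.sum_sum_skeletonWeight_mul fun v => e v - a]
      have hx : ∀ x ∈ X.faces.filter (dim · = 2), X.weight x *
          ((∑ v ∈ X.vertices with v ∈ x, (e v - a)) ^ 2 -
            ∑ v ∈ X.vertices with v ∈ x, (e v - a) ^ 2) =
          (1 - 4 * a) * (X.weight x * ∑ v ∈ X.vertices with v ∈ x, e v) +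
            6 * a ^ 2 * X.weight x := by
        intro x hx
        obtain ⟨hxf, hx2⟩ := Finset.mem_filter.mp hx
        have hc := X.card_filter_vertices_mem hxf
        rw [hx2] at hc
        have hN : ∑ v ∈ X.vertices with v ∈ x, e v =
            (#{v ∈ X.vertices | v ∈ x ∧ v ⬝ᵥ u = 1} : ℝ) := by
          rw [Finset.sum_boole, Finset.filter_filter]
        -- The values `0` and `2` are exactly the roots of `N ^ 2 = 2 * N`; this makes the quadratic
        -- form linear in the indicator.
        have hN2 : (∑ v ∈ X.vertices with v ∈ x, e v) ^ 2 =
            2 * ∑ v ∈ X.vertices with v ∈ x, e v := by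
          rcases X.card_filter_vertices_dotProduct hxf hx2 u with h | h <;>
            rw [hN, h] <;> norm_num
        have hsq (v : Fin k → ZMod 2) : (e v - a) ^ 2 = (1 - 2 * a) * e v + a ^ 2 := by
          linear_combination he2 v
        simp only [hsq, Finset.sum_sub_distrib, Finset.sum_add_distrib, ← Finset.mul_sum,
          Finset.sum_const, hc, nsmul_eq_mul]
        push_cast
        linear_combination X.weight x * hN2
      rw [Finset.sum_congr rfl hx, Finset.sum_add_distrib, ← Finset.mul_sum, ← Finset.mul_sum,
        ← h3, hsum, h4]
      ring
    · rfl
    · simp only [sum_skeletonWeight]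
      rw [Finset.sum_coe_sort X.vertices fun v => 6 * X.vertexWeight v * (e v - a) ^ 2]
      have hsq (v : Fin k → ZMod 2) : 6 * X.vertexWeight v * (e v - a) ^ 2 =
          6 * (1 - 2 * a) * (X.vertexWeight v * e v) + 6 * a ^ 2 * X.vertexWeight v := by
        linear_combination 6 * X.vertexWeight v * he2 v
      simp only [hsq]
      rw [Finset.sum_add_distrib, ← Finset.mul_sum, ← Finset.mul_sum, hsum, h1]
      ring
  · simp only [sum_skeletonWeight]
    rw [Finset.sum_coe_sort X.vertices fun v => 6 * X.vertexWeight v * (e v - a)]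
    simp only [mul_sub, mul_assoc]
    rw [Finset.sum_sub_distrib, ← Finset.mul_sum, ← Finset.mul_sum, ← Finset.sum_mul, hsum, h1]
    ring

lemma exists_dotProduct_eq_one
    (hspan : Submodule.span (ZMod 2) (X.vertices : Set (Fin k → ZMod 2)) = ⊤)
    {u : Fin k → ZMod 2} (hu : u ≠ 0) : ∃ v ∈ X.vertices, v ⬝ᵥ u = 1 := by
  by_contra! h
  have hzo : ∀ a : ZMod 2, a ≠ 1 → a = 0 := by decide
  refine hu (dotProduct_eq_zero u fun w => ?_)
  rw [dotProduct_comm]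
  have hw : w ∈ Submodule.span (ZMod 2) (X.vertices : Set (Fin k → ZMod 2)) := hspan ▸ trivial
  induction hw using Submodule.span_induction with
  | mem v hv => exact hzo _ (h v hv)
  | zero => exact zero_dotProduct u
  | add x y _ _ hx hy => rw [add_dotProduct, hx, hy, add_zero]
  | smul c x _ hx => rw [smul_dotProduct, hx, smul_zero]

/-- The vertices of an expanding complex form a biased set with respect to their weights. -/
theorem isBiasedWith (hpos : ∀ v ∈ X.vertices, 0 < X.vertexWeight v)
    (hspan : Submodule.span (ZMod 2) (X.vertices : Set (Fin k → ZMod 2)) = ⊤)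
    (hlam : X.expansion < 1) :
    IsBiasedWith X.vertices X.vertexWeight (X.expansion / (1 - X.expansion)) := by
  intro u hu
  obtain ⟨a, ha⟩ : ∃ a, a = ∑ s ∈ X.vertices with s ⬝ᵥ u = 1, X.vertexWeight s := ⟨_, rfl⟩
  rw [← ha]
  have hapos : 0 < a := by
    rw [ha]
    obtain ⟨v, hv, hvu⟩ := X.exists_dotProduct_eq_one hspan hu
    exact Finset.sum_pos (fun s hs => hpos s (Finset.mem_filter.mp hs).1)
      ⟨v, Finset.mem_filter.mpr ⟨hv, hvu⟩⟩
  have h := X.abs_bias_le hpos hlam ha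
  have hl0 : 0 ≤ X.expansion := spectralExpansion_nonneg
  set l := X.expansion
  have hl : 0 < 1 - l := by linarith
  obtain ⟨h1, h2⟩ := abs_le.mp h
  have h1' : 2 * a - 1 ≤ 2 * l * (1 - a) := by
    refine le_of_mul_le_mul_left ?_ hapos
    linarith
  have h2' : 1 - 2 * a ≤ 2 * l * (1 - a) := by
    refine le_of_mul_le_mul_left ?_ hapos
    linarith
  constructor
  · rw [div_le_iff₀ two_pos, sub_le_iff_le_add, ← sub_le_iff_le_add', le_div_iff₀ hl]
    linarith
  -- There is slack here: `h1'` says `(1 + l) * (2 * a - 1) ≤ l`, which is stronger than the goal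
  -- when `2 * a ≥ 1`; otherwise the goal is trivial.
  · rw [le_div_iff₀ two_pos, ← sub_le_iff_le_add', le_div_iff₀ hl]
    have ha1 : l * (2 * a - 1) ≤ l * (2 * l * (1 - a)) := mul_le_mul_of_nonneg_left h1' hl0
    nlinarith [mul_nonneg hl0 hl0, mul_pos hl hapos, mul_nonneg hl0 hapos.le]

/-! ### Regular complexes and their codes -/

/-- The vertex distribution of a regular complex is uniform. -/
lemma IsRegular.vertexWeight_eq {X : GrassmannianComplex k 1} (hX : X.IsRegular)
    {v : Fin k → ZMod 2} (hv : v ∈ X.vertices) : X.vertexWeight v = 1 / (#X.vertices : ℝ) := by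
  have hn : (#X.vertices : ℝ) ≠ 0 := by exact_mod_cast X.vertices_nonempty.card_ne_zero
  rw [eq_div_iff hn, ← X.sum_vertexWeight, Finset.sum_congr rfl fun w hw => hX w hw v hv,
    Finset.sum_const, nsmul_eq_mul, mul_comm]

theorem IsRegular.isBiased {X : GrassmannianComplex k 1} (hX : X.IsRegular) {ε : ℝ}
    (h : IsBiasedWith X.vertices X.vertexWeight ε) : IsBiased X.vertices ε := by
  intro u hu
  have := h u hu
  rwa [Finset.sum_congr rfl fun v hv => hX.vertexWeight_eq (Finset.mem_filter.mp hv).1,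
    Finset.sum_const, nsmul_eq_mul, mul_one_div] at this

lemma generatorMatrix_mulVec (u : Fin k → ZMod 2) (v : X.vertices) :
    X.generatorMatrix.mulVec u v = v.1 ⬝ᵥ u := rfl

lemma hammingNorm_generatorMatrix_mulVec (u : Fin k → ZMod 2) :
    hammingNorm (X.generatorMatrix.mulVec u) = #{s ∈ X.vertices | s ⬝ᵥ u = 1} := by
  have hzo : ∀ a : ZMod 2, a ≠ 0 ↔ a = 1 := by decide
  simp only [hammingNorm, generatorMatrix_mulVec, hzo]
  rw [← Finset.card_map (Function.Embedding.subtype _)]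
  congr 1
  ext v
  simp [and_comm]

theorem isBalanced_code {X : GrassmannianComplex k 1} {ε : ℝ} (h : IsBiased X.vertices ε) :
    IsBalanced X.code ε := by
  rintro _ ⟨u, rfl⟩ hc
  have hn : (0 : ℝ) < #X.vertices := by exact_mod_cast X.vertices_nonempty.card_pos
  have hu : u ≠ 0 := by
    rintro rfl
    exact hc (map_zero _)
  obtain ⟨h1, h2⟩ := h u hu
  rw [le_div_iff₀ hn] at h1
  rw [div_le_iff₀ hn] at h2
  rw [Matrix.mulVecLin_apply, hammingNorm_generatorMatrix_mulVec, Fintype.card_coe]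
  constructor <;> linarith

lemma code_ne_bot : X.code ≠ ⊥ := by
  intro h
  obtain ⟨v, hv⟩ := X.vertices_nonempty
  obtain ⟨j, hj⟩ := Function.ne_iff.mp (ne_zero_of_mem_vertices hv)
  -- This codeword is column `j` of the generator matrix, nonzero at the row `v`.
  have hmem : X.generatorMatrix.mulVec (Pi.single j 1) ∈ X.code := ⟨_, rfl⟩
  rw [h, Submodule.mem_bot] at hmem
  have := congrFun hmem ⟨v, hv⟩
  rw [generatorMatrix_mulVec, dotProduct_single_one] at this
  exact hj this

end GrassmannianComplex

/-- The relative distance of a nonzero balanced code. -/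
theorem IsBalanced.relativeDistance_mem {ι : Type*} [Fintype ι]
    {C : Submodule (ZMod 2) (ι → ZMod 2)} {ε : ℝ} (h : IsBalanced C ε) (hC : C ≠ ⊥) :
    relativeDistance C ∈ Set.Icc ((1 - ε) / 2) ((1 + ε) / 2) := by
  obtain ⟨c₀, hc₀, hne₀⟩ := Submodule.exists_mem_ne_zero_of_ne_bot hC
  obtain ⟨i, -⟩ := Function.ne_iff.mp hne₀
  have hn : (0 : ℝ) < Fintype.card ι := by exact_mod_cast Fintype.card_pos_iff.mpr ⟨i⟩
  -- A nonzero codeword makes the set of distances nonempty, so the infimum is attained rather than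
  -- the default `0`.
  obtain ⟨c, hc, c', hc', hne, hd⟩ := Nat.sInf_mem
    (s := {d : ℕ | ∃ c ∈ C, ∃ c' ∈ C, c ≠ c' ∧ hammingDist c c' = d})
    ⟨_, c₀, hc₀, 0, C.zero_mem, hne₀, rfl⟩
  obtain ⟨h1, h2⟩ := h (-c + c') (C.add_mem (C.neg_mem hc) hc')
    (mt neg_add_eq_zero.mp hne)
  rw [← hammingDist_eq_hammingNorm] at h1 h2
  rw [relativeDistance, ← hd]
  constructor
  · rw [le_div_iff₀ hn]
    linarith
  · rw [div_le_iff₀ hn]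
    linarith

end GrassmannianCode

theorem mainTheorem8 (k : ℕ) (X : GrassmannianCode.GrassmannianComplex k 1)
    (hpos : ∀ v ∈ X.vertices, 0 < X.vertexWeight v)
    (hspan : Submodule.span (ZMod 2) (X.vertices : Set (Fin k → ZMod 2)) = ⊤)
    (hlam : X.expansion < 1) :
    GrassmannianCode.IsBiasedWith X.vertices X.vertexWeight (X.expansion / (1 - X.expansion)) ∧
    (X.IsRegular →
      GrassmannianCode.IsBiased X.vertices (X.expansion / (1 - X.expansion)) ∧
      GrassmannianCode.IsBalanced X.code (X.expansion / (1 - X.expansion)) ∧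
      X.code ≠ ⊥ ∧
      GrassmannianCode.relativeDistance X.code ∈
        Set.Icc ((1 - X.expansion / (1 - X.expansion)) / 2)
          ((1 + X.expansion / (1 - X.expansion)) / 2)) := by
  have hbias := X.isBiasedWith hpos hspan hlam
  refine ⟨hbias, fun hX => ?_⟩
  have hbal := GrassmannianCode.GrassmannianComplex.isBalanced_code (hX.isBiased hbias)
  exact ⟨hX.isBiased hbias, hbal, X.code_ne_bot, hbal.relativeDistance_mem X.code_ne_bot⟩
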